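/- Let $X$ and $A$ be standard Borel spaces. For each $x\in X$ let $A(x)\subset A$ be a set of available actions such that $Gr(A)=\{(x,a):x\in X,\ a\in A(x)\}$ is a measurable subset of $X\times A$ that contains the graph of a measurable mapping from $X$ to $A$. For $(x,a)\in Gr(A)$ let $\tilde q(x,a,\cdot)$ be a finite signed measure on $X$ with $\tilde q(x,a,X)=0$ and $\tilde q(x,a,Z\setminus\{x\})\ge 0$ for all measurable $Z\subset X$, such that $\tilde q(x,a,Z)$ is measurable in $(x,a)\in Gr(A)$ for every measurable $Z$, and $\sup_{a\in A(x)}\tilde q(x,a,X\setminus\{x\})<\infty$ for every $x\in X$. Put $\bar X=X\cup\{x_\infty\}$ and $\bar A=A\cup\{a_\infty\}$ with isolated added points. Let $\Omega$ be the set of sequences $\omega=(x_0,t_1,x_1,t_2,x_2,\dots)$ with $x_n\in\bar X$, $t_n\in\,]0,\infty]$, $x_0\in X$, such that for $n\ge1$: if $t_n<\infty$, then $t_n<t_{n+1}$ and $x_n\in X$; if $t_n=\infty$, then $t_{n+1}=\infty$ and $x_n=x_\infty$. It carries the $\sigma$-algebra induced by the product $\sigma$-algebra. Put $t_0=0$,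 $t_\infty=\lim_n t_n$, $\mathbb X_t=x_n$ for $t\in[t_n,t_{n+1}[$, $\mathbb X_t=x_\infty$ for $t\ge t_\infty$, and $\mathbb X_{0-}=\mathbb X_0$. Let $\mathcal F_t$ be generated by $x_0$ and the events $\{x_n\in B,\ t_n\le s\}$ with $n\ge1$, $s\le t$, $B\subset X$ measurable. A policy $\pi$ assigns to each $(\omega,t)\in\Omega\times\mathbb R_+$ a probability measure $\pi(\cdot\,|\,\omega,t)$ on $\bar A$ such that $\pi(B\,|\,\omega,t)$ is a predictable process for every measurable $B\subset A$, $\pi(A(\mathbb X_{t-}(\omega))\,|\,\omega,t)=1$ for $t<t_\infty(\omega)$, and $\pi(\cdot\,|\,\omega,t)=\delta_{a_\infty}$ for $t\ge t_\infty(\omega)$. A Markov policy is a transition probability $\varphi(da\,|\,x,t)$ from $X\times\mathbb R_+$ to $A$ with $\varphi(A(x)\,|\,x,t)=1$ for all $x\in X$ and $t\in\mathbb R_+$; as a policy, it is $\varphi(\cdot\,|\,\mathbb X_{t-}(\omega),t)$ for $t<t_\infty(\omega)$. For a probability measure $\gamma$ on $X$ and a policy $\pi$, let $\mathbb P_\gamma^\pi$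 be the probability measure on $\Omega$ for which $x_0$ has distribution $\gamma$ and the random measure $$\nu^\pi(\omega;[0,t],B)=\int_0^t\int_{A(\mathbb X_s)}\tilde q(\mathbb X_s,a,B\setminus\{\mathbb X_s\})\,\pi(da\,|\,\omega,s)\,I\{\mathbb X_s\in X\}\,ds$$ is the compensator of the multivariate point process $(t_n,x_n)_{n\ge1}$, that is, $$\mathbb E_\gamma^\pi\sum_{n\ge1:\,t_n<\infty}W(\omega,t_n,x_n)=\mathbb E_\gamma^\pi\int W(\omega,s,y)\,\nu^\pi(\omega;ds,dy)$$ for every nonnegative function $W$ that is measurable with respect to the product of the predictable $\sigma$-algebra and the $\sigma$-algebra of $X$. For measurable $B\subset X$ and $U\subset A$ put $$P_\gamma^\pi(t,B)=\mathbb P_\gamma^\pi(\mathbb X_t\in B),\qquad P_\gamma^\pi(t,B,U)=\mathbb P_\gamma^\pi(\mathbb X_t\in B,\ a_t\in U)=\mathbb E_\gamma^\pi\big[I\{\mathbb X_t\in B\}\,\pi(U\,|\,\omega,t)\big].$$ Lemma. For every initial distribution $\gamma$ on $X$ and every policy $\pi$ there exists a Markov policy $\varphi$ (in particular, $\varphi(A(x)\,|\,x,t)=1$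 for all $x\in X$ and $t\in\mathbb R_+$) such that for all $t\in\mathbb R_+$ and all measurable $U\subset A$ the measure $P_\gamma^\pi(t,\cdot,U)$ is absolutely continuous with respect to $P_\gamma^\pi(t,\cdot)$ and $$\varphi(U\,|\,x,t)=\frac{P_\gamma^\pi(t,dx,U)}{P_\gamma^\pi(t,dx)}\qquad\text{for }P_\gamma^\pi(t,\cdot)\text{-almost every }x\in X.$$ -/

import Mathlib

open MeasureTheory ProbabilityTheory
open scoped NNReal ENNReal

namespace CTJMDP

/-! ### The space of trajectories

A space `X` enlarged by one isolated point is the disjoint union `X ⊕ Unit`, with the disjoint-union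
σ-algebra: `Sum.inl x` is the point `x` of `X`, and `Sum.inr ()` is the added point
(`x_∞` for states, `a_∞` for actions). -/

/-- The sequence `(x_0, t_1, x_1, t_2, x_2, …)`, given by the marks `ω.1 n = x_n` and the epochs
`ω.2 n = t_n` with the convention `t_0 = 0`, is a trajectory of a jump process: if `t_n < ∞`, then
`t_n < t_{n+1}` and `x_n` is a genuine state; if `t_n = ∞`, then `t_{n+1} = ∞` and `x_n = x_∞`.
(For `n = 0` this says that `x_0` is a genuine state and `t_1 > 0`.) -/
def IsTrajectory {X : Type*} (ω : (ℕ → X ⊕ Unit) × (ℕ → ℝ≥0∞)) : Prop :=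
  ω.2 0 = 0 ∧
  ∀ n, (ω.2 n < ⊤ → ω.2 n < ω.2 (n + 1) ∧ ∃ x : X, ω.1 n = Sum.inl x) ∧
    (ω.2 n = ⊤ → ω.2 (n + 1) = ⊤ ∧ ω.1 n = Sum.inr ())

/-- The sample space `Ω`, with the σ-algebra induced by the product σ-algebra. -/
abbrev Trajectory (X : Type*) : Type _ :=
  {ω : (ℕ → X ⊕ Unit) × (ℕ → ℝ≥0∞) // IsTrajectory ω}

namespace Trajectory

variable {X : Type*}

/-- `x_n(ω)`. -/
def mark (ω : Trajectory X) (n : ℕ) : X ⊕ Unit := ω.1.1 n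

/-- `t_n(ω)`, where `t_0 = 0`. -/
def epoch (ω : Trajectory X) (n : ℕ) : ℝ≥0∞ := ω.1.2 n

/-- `t_∞(ω) = lim t_n(ω)`; the sequence `t_n(ω)` is nondecreasing. -/
noncomputable def explosionTime (ω : Trajectory X) : ℝ≥0∞ := ⨆ n, ω.epoch n

open Classical in
/-- The jump process: `𝕏_t = x_n` for `t ∈ [t_n, t_{n+1}[`, and `𝕏_t = x_∞` for `t ≥ t_∞`. -/
noncomputable def state (ω : Trajectory X) (t : ℝ≥0) : X ⊕ Unit :=
  if h : ∃ n, ω.epoch n ≤ t ∧ (t : ℝ≥0∞) < ω.epoch (n + 1) then ω.mark (Nat.find h)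
  else Sum.inr ()

open Classical in
/-- The left limit `𝕏_{t-}` for `t < t_∞`: it is `x_n` for `t ∈ ]t_n, t_{n+1}]`, and, as usual,
`𝕏_{0-} = 𝕏_0 = x_0`. (The value for `t ≥ t_∞` is set to `x_∞` and is never used.) -/
noncomputable def leftState (ω : Trajectory X) (t : ℝ≥0) : X ⊕ Unit :=
  if t = 0 then ω.mark 0
  else if h : ∃ n, ω.epoch n < t ∧ (t : ℝ≥0∞) ≤ ω.epoch (n + 1) then ω.mark (Nat.find h)
  else Sum.inr ()

variable [MeasurableSpace X]

theorem measurable_mark (n : ℕ) : Measurable fun ω : Trajectory X => ω.mark n :=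
  (measurable_pi_apply n).comp (measurable_fst.comp measurable_subtype_coe)

theorem measurable_epoch (n : ℕ) : Measurable fun ω : Trajectory X => ω.epoch n :=
  (measurable_pi_apply n).comp (measurable_snd.comp measurable_subtype_coe)

/-- The filtration `ℱ_t`, generated by `x_0` and by the events `{x_n ∈ B, t_n ≤ s}` with `n ≥ 1`,
`s ≤ t` and `B` a measurable set of states. -/
def filtration (X : Type*) [MeasurableSpace X] :
    Filtration ℝ≥0 (inferInstance : MeasurableSpace (Trajectory X)) where
  seq t := MeasurableSpace.comap (fun ω : Trajectory X => ω.mark 0) inferInstance ⊔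
    MeasurableSpace.generateFrom
      {S | ∃ n : ℕ, ∃ s : ℝ≥0, s ≤ t ∧ ∃ B : Set X, MeasurableSet B ∧
        S = {ω : Trajectory X | ω.mark (n + 1) ∈ Sum.inl '' B ∧ ω.epoch (n + 1) ≤ s}}
  mono' := by
    intro s t hst
    refine sup_le_sup le_rfl (MeasurableSpace.generateFrom_mono ?_)
    rintro S ⟨n, r, hr, B, hB, rfl⟩
    exact ⟨n, r, hr.trans hst, B, hB, rfl⟩
  le' := by
    intro t
    refine sup_le (measurable_mark 0).comap_le (MeasurableSpace.generateFrom_le ?_)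
    rintro S ⟨n, r, -, B, hB, rfl⟩
    exact (measurable_mark (n + 1) hB.inl_image).inter
      (measurableSet_le (measurable_epoch (n + 1)) measurable_const)

end Trajectory

/-! ### The controlled model -/

/-- A continuous-time jump Markov decision process `{X, A, A(·), q̃}` with state space `X` and action
space `A`. -/
structure Model (X A : Type*) [MeasurableSpace X] [MeasurableSpace A] where
  /-- The set `A(x)` of actions available at `x`. -/
  actions : X → Set A
  /-- `Gr(A)` is measurable. -/
  measurableSet_graph : MeasurableSet {p : X × A | p.2 ∈ actions p.1}
  /-- `Gr(A)` contains the graph of a measurable mapping (so every `A(x)` is non-empty). -/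
  exists_selector : ∃ f : X → A, Measurable f ∧ ∀ x, f x ∈ actions x
  /-- The transition rate `q̃(x, a, ·)`, defined for `(x, a) ∈ Gr(A)`. -/
  rate : {p : X × A // p.2 ∈ actions p.1} → SignedMeasure X
  rate_univ : ∀ p, rate p Set.univ = 0
  rate_nonneg : ∀ p Z, MeasurableSet Z → 0 ≤ rate p (Z \ {p.1.1})
  measurable_rate : ∀ Z, MeasurableSet Z → Measurable fun p => rate p Z
  /-- `sup_{a ∈ A(x)} q̃(x, a, X \ {x}) < ∞` for every `x`. -/
  rate_bounded : ∀ x, ∃ C : ℝ, ∀ a, ∀ h : a ∈ actions x, rate ⟨(x, a), h⟩ (Set.univ \ {x}) ≤ C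

namespace Model

variable {X A : Type*} [MeasurableSpace X] [MeasurableSpace A]

/-- The measure `Z ↦ q̃(x, a, Z \ {x})` on `X` for `(x, a) ∈ Gr(A)`. It is set to zero off `Gr(A)`,
so that integrals over `a` of this measure are integrals over `A(x)`, and at the added points,
where `q̃(x_∞, a_∞) = 0`. -/
noncomputable def jumpMeasure [MeasurableSingletonClass X] (M : Model X A) :
    X ⊕ Unit → A ⊕ Unit → Measure X
  | Sum.inl x, Sum.inl a =>
    open Classical in
    if h : a ∈ M.actions x then
      (M.rate ⟨(x, a), h⟩).toMeasureOfZeroLE {x}ᶜ (measurableSet_singleton x).compl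
        (VectorMeasure.restrict_le_restrict_of_subset_le _ _ fun Z hZ hZx => by
          have h0 := M.rate_nonneg ⟨(x, a), h⟩ Z hZ
          rwa [Set.sdiff_singleton_eq_self fun hx => hZx hx rfl] at h0)
    else 0
  | _, _ => 0

/-- A (randomized, history-dependent) policy `π(da | ω, t)`; `A ⊕ Unit` is `A` with the isolated
action `a_∞` added. -/
structure Policy (M : Model X A) where
  toFun : ℝ≥0 → Trajectory X → Measure (A ⊕ Unit)
  isProbabilityMeasure : ∀ t ω, IsProbabilityMeasure (toFun t ω)
  /-- `π(B | ω, t)` is predictable for every measurable set `B` of actions. -/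
  predictable : ∀ B : Set A, MeasurableSet B →
    IsStronglyPredictable (Trajectory.filtration X) fun t ω => toFun t ω (Sum.inl '' B)
  /-- `π(A(𝕏_{t-}) | ω, t) = 1` for `t < t_∞`. -/
  feasible : ∀ (t : ℝ≥0) (ω : Trajectory X), (t : ℝ≥0∞) < ω.explosionTime →
    ∀ x, ω.leftState t = Sum.inl x → toFun t ω (Sum.inl '' M.actions x) = 1
  /-- `π(· | ω, t)` is concentrated at `a_∞` for `t ≥ t_∞`. -/
  exploded : ∀ (t : ℝ≥0) (ω : Trajectory X), ω.explosionTime ≤ t →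
    toFun t ω = Measure.dirac (Sum.inr ())

/-- A Markov policy: a transition probability `φ(da | x, t)` from `X × ℝ_+` to `A` such that
`φ(A(x) | x, t) = 1` for all `x` and `t`. -/
structure MarkovPolicy (M : Model X A) where
  kernel : Kernel (X × ℝ≥0) A
  isMarkovKernel : IsMarkovKernel kernel
  feasible : ∀ x t, kernel (x, t) (M.actions x) = 1

/-- The policy `π` is the Markov policy `φ`: `π(· | ω, t) = φ(· | 𝕏_{t-}(ω), t)` for `t < t_∞(ω)`. -/
def Policy.IsGivenBy {M : Model X A} (π : M.Policy) (φ : M.MarkovPolicy) : Prop :=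
  ∀ (t : ℝ≥0) (ω : Trajectory X), (t : ℝ≥0∞) < ω.explosionTime →
    ∀ x, ω.leftState t = Sum.inl x → π.toFun t ω = (φ.kernel (x, t)).map Sum.inl

/-- The integral `∫ W(s, y) ν^π(ω; ds, dy)` of a nonnegative function with respect to the random
measure
`ν^π(ω; [0, t], B) = ∫_0^t q̃(𝕏_s, π_s, B \ {𝕏_s}) I{𝕏_s ∈ X} ds`,
`q̃(x, p, B) = ∫_{A(x)} q̃(x, a, B) p(da)`. -/
noncomputable def compensatorIntegral [MeasurableSingletonClass X] (M : Model X A) (π : M.Policy)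
    (ω : Trajectory X) (W : ℝ≥0 → X → ℝ≥0∞) : ℝ≥0∞ :=
  ∫⁻ s in Set.Ioi (0 : ℝ), ∫⁻ a, ∫⁻ y, W s.toNNReal y
    ∂(M.jumpMeasure (ω.state s.toNNReal) a) ∂(π.toFun s.toNNReal ω)

/-- The integral `∑_{n ≥ 1, t_n < ∞} W(t_n, x_n)` of a nonnegative function with respect to the
random counting measure of the multivariate point process `(t_n, x_n)_{n ≥ 1}`. (Note that
`x_n ∈ X` exactly when `t_n < ∞`.) -/
noncomputable def pointIntegral (ω : Trajectory X) (W : ℝ≥0 → X → ℝ≥0∞) : ℝ≥0∞ :=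
  ∑' n : ℕ, Sum.elim (fun y => W (ω.epoch (n + 1)).toNNReal y) (fun _ => 0) (ω.mark (n + 1))

/-- `P` is the law `ℙ_γ^π` on the space of trajectories: it is the probability measure for which
`x_0` has distribution `γ` and the random measure `ν^π` is the compensator (dual predictable
projection) of the random measure of the multivariate point process `(t_n, x_n)_{n ≥ 1}`, that is,
`𝔼 ∑_{n ≥ 1, t_n < ∞} W(t_n, x_n) = 𝔼 ∫ W(s, y) ν^π(ds, dy)` for every nonnegative function
`W(ω, s, y)` that is measurable for the product of the predictable σ-algebra and that of `X`. -/
structure IsLaw [MeasurableSingletonClass X] (M : Model X A) (γ : Measure X) (π : M.Policy)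
    (P : Measure (Trajectory X)) : Prop where
  isProbabilityMeasure : IsProbabilityMeasure P
  initial : P.map (fun ω => ω.mark 0) = γ.map Sum.inl
  compensator : ∀ W : (ℝ≥0 × Trajectory X) × X → ℝ≥0∞,
    Measurable[(Trajectory.filtration X).predictable.prod inferInstance] W →
    ∫⁻ ω, pointIntegral ω (fun s y => W ((s, ω), y)) ∂P =
      ∫⁻ ω, M.compensatorIntegral π ω (fun s y => W ((s, ω), y)) ∂P

/-- The measure `B ↦ P(t, B) = P(𝕏_t ∈ B)` on `X`. -/
noncomputable def stateMarginal (P : Measure (Trajectory X)) (t : ℝ≥0) : Measure X :=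
  (P.map fun ω => ω.state t).comap Sum.inl

/-- The measure `B ↦ P(t, B, U) = P(𝕏_t ∈ B, a_t ∈ U)` on `X` for a set `U` of actions, where,
given the trajectory `ω`, the action `a_t` has distribution `π(· | ω, t)`; in other words,
`P(t, B, U) = ∫ I{𝕏_t(ω) ∈ B} π(U | ω, t) P(dω)`. -/
noncomputable def stateActionMarginal {M : Model X A} (π : M.Policy) (P : Measure (Trajectory X))
    (t : ℝ≥0) (U : Set A) : Measure X :=
  ((P.withDensity fun ω => π.toFun t ω (Sum.inl '' U)).map fun ω => ω.state t).comap Sum.inl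

end Model

end CTJMDP

namespace CTJMDP

/-! The policy `φ` is the conditional law of `a_t` given `𝕏_t = x`. To have it measurable in `(x,
t)` jointly, the laws of `(𝕏_t, a_t)` on `X × A` are assembled into one finite kernel in `t`
(`stateActionKernel`). Since the spaces are standard Borel, this kernel disintegrates over its first
marginal with a conditional kernel measurable in both variables (`condActionKernel`).

The delicate point is feasibility: a policy is concentrated on `A(𝕏_{t-})`, while the marginals
involve `𝕏_t`. The compensator is absolutely continuous in time, so no jump occurs at a fixed `t`
almost surely (`IsLaw.ae_epoch_ne`), and the two states agree. Hence the first marginal is the law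
of `𝕏_t` on `X`, and the joint law lives on `Gr(A)`. So for each `t` the conditional law charges
`A(x)` fully for almost every `x`; on the exceptional set, measurable in `(x, t)`, a measurable
selector replaces it.

That `φ` defines a policy rests on the predictability of `𝕏_{t-}` (`measurable_leftState`). -/

theorem measurable_of_inl_preimage {α X : Type*} [MeasurableSpace α] [MeasurableSpace X]
    {f : α → X ⊕ Unit} (h : ∀ B : Set X, MeasurableSet B → MeasurableSet (f ⁻¹' (Sum.inl '' B))) :
    Measurable f := by
  intro s hs
  have h1 := h _ (measurable_inl hs)
  have h2 := (h _ MeasurableSet.univ).compl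
  by_cases hr : Sum.inr () ∈ s
  · convert h1.union h2 using 1
    ext a
    rcases hfa : f a with x | ⟨⟩ <;> simp [hfa, hr]
  · convert h1 using 1
    ext a
    rcases hfa : f a with x | ⟨⟩ <;> simp [hfa, hr]

theorem measurableEmbedding_sum_inl {α β : Type*} [MeasurableSpace α] [MeasurableSpace β] :
    MeasurableEmbedding (Sum.inl : α → α ⊕ β) where
  injective := Sum.inl_injective
  measurable := measurable_inl
  measurableSet_image' _ hs := hs.inl_image

/-! ### Trajectories: states, left limits and predictability. -/

namespace Trajectory

variable {X : Type*}

theorem epoch_zero (ω : Trajectory X) : ω.epoch 0 = 0 := ω.2.1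

theorem epoch_lt_succ (ω : Trajectory X) {n : ℕ} (h : ω.epoch n < ⊤) :
    ω.epoch n < ω.epoch (n + 1) := ((ω.2.2 n).1 h).1

theorem exists_mark_eq (ω : Trajectory X) {n : ℕ} (h : ω.epoch n < ⊤) :
    ∃ x, ω.mark n = Sum.inl x := ((ω.2.2 n).1 h).2

theorem mark_eq_inr (ω : Trajectory X) {n : ℕ} (h : ω.epoch n = ⊤) :
    ω.mark n = Sum.inr () := ((ω.2.2 n).2 h).2

theorem mark_mem_inl_iff (ω : Trajectory X) {n : ℕ} :
    ω.mark n ∈ Sum.inl '' (Set.univ : Set X) ↔ ω.epoch n < ⊤ := by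
  constructor
  · rintro ⟨x, -, hx⟩
    by_contra h
    rw [ω.mark_eq_inr (not_lt_top_iff.1 h)] at hx
    simp at hx
  · intro h
    obtain ⟨x, hx⟩ := ω.exists_mark_eq h
    exact ⟨x, trivial, hx.symm⟩

theorem monotone_epoch (ω : Trajectory X) : Monotone ω.epoch := by
  refine monotone_nat_of_le_succ fun n => ?_
  by_cases h : ω.epoch n < ⊤
  · exact (ω.epoch_lt_succ h).le
  · have h' := not_lt_top_iff.1 h
    rw [h', show ω.epoch (n + 1) = ⊤ from ((ω.2.2 n).2 h').1]

theorem explosionTime_pos (ω : Trajectory X) : 0 < ω.explosionTime := by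
  refine lt_of_lt_of_le ?_ (le_iSup ω.epoch 1)
  simpa [ω.epoch_zero] using ω.epoch_lt_succ (n := 0) (by simp [ω.epoch_zero])

/-- The intervals `[t_n, t_{n+1}[` are disjoint because the epochs are monotone, so `Nat.find` picks
the only possible index. -/
theorem state_mem_iff (ω : Trajectory X) (t : ℝ≥0) (B : Set X) :
    ω.state t ∈ Sum.inl '' B ↔
      ∃ n, (ω.epoch n ≤ t ∧ (t : ℝ≥0∞) < ω.epoch (n + 1)) ∧ ω.mark n ∈ Sum.inl '' B := by
  classical
  unfold state
  split_ifs with h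
  · constructor
    · exact fun hm => ⟨_, Nat.find_spec h, hm⟩
    · rintro ⟨n, hn, hm⟩
      have hf := Nat.find_spec h
      have h1 : Nat.find h = n := by
        refine le_antisymm (Nat.find_min' h hn) ?_
        by_contra! hlt
        exact absurd ((ω.monotone_epoch (Nat.succ_le_of_lt hlt)).trans hn.1) (not_le.2 hf.2)
      rwa [h1]
  · constructor
    · rintro ⟨x, -, hx⟩
      simp at hx
    · rintro ⟨n, hn, -⟩
      exact absurd ⟨n, hn⟩ h

theorem leftState_mem_iff (ω : Trajectory X) (t : ℝ≥0) (B : Set X) :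
    ω.leftState t ∈ Sum.inl '' B ↔
      (t = 0 ∧ ω.mark 0 ∈ Sum.inl '' B) ∨
      ∃ n, (ω.epoch n < t ∧ (t : ℝ≥0∞) ≤ ω.epoch (n + 1)) ∧ ω.mark n ∈ Sum.inl '' B := by
  classical
  unfold leftState
  split_ifs with h0 h
  · simp [h0]
  · constructor
    · exact fun hm => Or.inr ⟨_, Nat.find_spec h, hm⟩
    · rintro (⟨h', -⟩ | ⟨n, hn, hm⟩)
      · exact absurd h' h0
      have hf := Nat.find_spec h
      have h1 : Nat.find h = n := by
        refine le_antisymm (Nat.find_min' h hn) ?_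
        by_contra! hlt
        exact absurd (hf.2.trans (ω.monotone_epoch (Nat.succ_le_of_lt hlt))) (not_le.2 hn.1)
      rwa [h1]
  · constructor
    · rintro ⟨x, -, hx⟩
      simp at hx
    · rintro (⟨h', -⟩ | ⟨n, hn, -⟩)
      · exact absurd h' h0
      · exact absurd ⟨n, hn⟩ h

theorem lt_explosionTime_of_leftState_eq (ω : Trajectory X) {t : ℝ≥0} {x : X}
    (h : ω.leftState t = Sum.inl x) : (t : ℝ≥0∞) < ω.explosionTime := by
  have hm : ω.leftState t ∈ Sum.inl '' (Set.univ : Set X) := ⟨x, trivial, h.symm⟩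
  rcases (ω.leftState_mem_iff t _).1 hm with ⟨rfl, -⟩ | ⟨n, hn, -⟩
  · simpa using ω.explosionTime_pos
  -- A finite `t_{n+1}` lies strictly below `t_{n+2}`; an infinite one already exceeds `t`.
  · by_cases htop : ω.epoch (n + 1) < ⊤
    · exact hn.2.trans_lt ((ω.epoch_lt_succ htop).trans_le (le_iSup ω.epoch _))
    · refine lt_of_lt_of_le ?_ (le_iSup ω.epoch (n + 1))
      rw [not_lt_top_iff.1 htop]
      exact ENNReal.coe_lt_top

theorem state_eq_leftState (ω : Trajectory X) {t : ℝ≥0} (h : ∀ n, ω.epoch (n + 1) ≠ t) :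
    ω.state t = ω.leftState t := by
  classical
  -- Time zero is separate: it equals `t_0`, which the hypothesis does not exclude.
  by_cases h0 : t = 0
  · subst h0
    have hex : ∃ n, ω.epoch n ≤ (0 : ℝ≥0) ∧ ((0 : ℝ≥0) : ℝ≥0∞) < ω.epoch (n + 1) :=
      ⟨0, by simp [ω.epoch_zero], by
        simpa [ω.epoch_zero] using ω.epoch_lt_succ (n := 0) (by simp [ω.epoch_zero])⟩
    have hf : Nat.find hex = 0 := (Nat.find_eq_zero hex).2 ⟨by simp [ω.epoch_zero], by
        simpa [ω.epoch_zero] using ω.epoch_lt_succ (n := 0) (by simp [ω.epoch_zero])⟩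
    rw [state, dif_pos hex, leftState, if_pos rfl, hf]
  · have hne : ∀ n, ω.epoch n ≠ t := by
      rintro (_ | n)
      · rw [ω.epoch_zero]
        exact fun h' => h0 (by exact_mod_cast h'.symm)
      · exact h n
    have hiff : ∀ n, (ω.epoch n ≤ t ∧ (t : ℝ≥0∞) < ω.epoch (n + 1)) ↔
        (ω.epoch n < t ∧ (t : ℝ≥0∞) ≤ ω.epoch (n + 1)) := fun n =>
      and_congr ⟨fun h' => lt_of_le_of_ne h' (hne n), le_of_lt⟩
        ⟨le_of_lt, fun h' => lt_of_le_of_ne h' (hne (n + 1)).symm⟩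
    simp only [state, leftState, if_neg h0, hiff]

variable [MeasurableSpace X]

theorem measurable_state :
    Measurable fun p : ℝ≥0 × Trajectory X => p.2.state p.1 := by
  refine measurable_of_inl_preimage fun B hB => ?_
  have hEq : (fun p : ℝ≥0 × Trajectory X => p.2.state p.1) ⁻¹' (Sum.inl '' B) =
      ⋃ n, ({p | p.2.epoch n ≤ p.1} ∩ {p | (p.1 : ℝ≥0∞) < p.2.epoch (n + 1)}) ∩
        {p | p.2.mark n ∈ Sum.inl '' B} := by
    ext p
    simp only [Set.mem_preimage, state_mem_iff, Set.mem_iUnion, Set.mem_inter_iff,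
      Set.mem_ofPred_eq]
  rw [hEq]
  have ht : Measurable fun p : ℝ≥0 × Trajectory X => (p.1 : ℝ≥0∞) :=
    measurable_fst.coe_nnreal_ennreal
  have he (n : ℕ) : Measurable fun p : ℝ≥0 × Trajectory X => p.2.epoch n :=
    (measurable_epoch n).comp measurable_snd
  exact MeasurableSet.iUnion fun n =>
    ((measurableSet_le (he n) ht).inter (measurableSet_lt ht (he (n + 1)))).inter
      (((measurable_mark n).comp measurable_snd) hB.inl_image)

theorem measurableSet_filtration_mark_zero (t : ℝ≥0) {B : Set X} (hB : MeasurableSet B) :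
    MeasurableSet[filtration X t] {ω : Trajectory X | ω.mark 0 ∈ Sum.inl '' B} := by
  have h : MeasurableSet[MeasurableSpace.comap (fun ω : Trajectory X => ω.mark 0) inferInstance]
      {ω : Trajectory X | ω.mark 0 ∈ Sum.inl '' B} := ⟨_, hB.inl_image, rfl⟩
  exact (le_sup_left : _ ≤ (filtration X t : MeasurableSpace (Trajectory X))) _ h

theorem measurableSet_filtration_mark_epoch (t : ℝ≥0) (n : ℕ) {B : Set X}
    (hB : MeasurableSet B) :
    MeasurableSet[filtration X t]
      {ω : Trajectory X | ω.mark n ∈ Sum.inl '' B ∧ ω.epoch n ≤ t} := by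
  rcases n with _ | n
  · convert measurableSet_filtration_mark_zero t hB using 2
    simp [epoch_zero]
  · have h : MeasurableSet[MeasurableSpace.generateFrom
        {S | ∃ n : ℕ, ∃ s : ℝ≥0, s ≤ t ∧ ∃ B : Set X, MeasurableSet B ∧
          S = {ω : Trajectory X | ω.mark (n + 1) ∈ Sum.inl '' B ∧ ω.epoch (n + 1) ≤ s}}]
        {ω : Trajectory X | ω.mark (n + 1) ∈ Sum.inl '' B ∧ ω.epoch (n + 1) ≤ t} :=
      MeasurableSpace.measurableSet_generateFrom ⟨n, t, le_rfl, B, hB, rfl⟩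
    exact (le_sup_right : _ ≤ (filtration X t : MeasurableSpace (Trajectory X))) _ h

/-- A rational `q` between `t_n` and `t` splits the event into predictable rectangles `]q, ∞[ × F`
with `F ∈ ℱ_q`. -/
theorem measurableSet_predictable_epoch_lt (n : ℕ) {B : Set X} (hB : MeasurableSet B) :
    MeasurableSet[(filtration X).predictable]
      {p : ℝ≥0 × Trajectory X | p.2.epoch n < p.1 ∧ p.2.mark n ∈ Sum.inl '' B} := by
  have hEq : {p : ℝ≥0 × Trajectory X | p.2.epoch n < p.1 ∧ p.2.mark n ∈ Sum.inl '' B} =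
      ⋃ q : ℚ, Set.Ioi (Real.toNNReal q) ×ˢ
        {ω : Trajectory X | ω.mark n ∈ Sum.inl '' B ∧ ω.epoch n ≤ (Real.toNNReal q : ℝ≥0)} := by
    ext ⟨t, ω⟩
    simp only [Set.mem_ofPred_eq, Set.mem_iUnion, Set.mem_prod, Set.mem_Ioi]
    constructor
    · rintro ⟨h1, h2⟩
      obtain ⟨q, -, hq1, hq2⟩ := ENNReal.lt_iff_exists_rat_btwn.1 h1
      exact ⟨q, by exact_mod_cast hq2, h2, hq1.le⟩
    · rintro ⟨q, hq1, h2, hq2⟩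
      exact ⟨hq2.trans_lt (by exact_mod_cast hq1), h2⟩
  rw [hEq]
  exact MeasurableSet.iUnion fun q =>
    measurableSet_predictable_Ioi_prod (measurableSet_filtration_mark_epoch _ n hB)

/-- The left-limit process `𝕏_{t-}` is predictable. -/
theorem measurable_leftState :
    Measurable[(filtration X).predictable] fun p : ℝ≥0 × Trajectory X => p.2.leftState p.1 := by
  let _ : MeasurableSpace (ℝ≥0 × Trajectory X) := (filtration X).predictable
  refine measurable_of_inl_preimage fun B hB => ?_
  have hEq : (fun p : ℝ≥0 × Trajectory X => p.2.leftState p.1) ⁻¹' (Sum.inl '' B) =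
      ({⊥} ×ˢ {ω : Trajectory X | ω.mark 0 ∈ Sum.inl '' B}) ∪
      ⋃ n, {p : ℝ≥0 × Trajectory X | p.2.epoch n < p.1 ∧ p.2.mark n ∈ Sum.inl '' B} \
        {p | p.2.epoch (n + 1) < p.1 ∧ p.2.mark (n + 1) ∈ Sum.inl '' (Set.univ : Set X)} := by
    ext ⟨t, ω⟩
    -- An epoch below `t` is automatically finite, so `t ≤ t_{n+1}` is the complement of an event
    -- covered by `measurableSet_predictable_epoch_lt`.
    have hlt (n : ℕ) : ¬ (ω.epoch (n + 1) < t ∧ ω.epoch (n + 1) < ⊤) ↔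
        (t : ℝ≥0∞) ≤ ω.epoch (n + 1) := by
      rw [← not_lt, not_iff_not]
      exact ⟨fun h => h.1, fun h => ⟨h, h.trans ENNReal.coe_lt_top⟩⟩
    simp only [Set.mem_preimage, leftState_mem_iff, Set.mem_union, Set.mem_prod,
      Set.mem_singleton_iff, Set.mem_ofPred_eq, Set.mem_iUnion, Set.mem_sdiff, mark_mem_inl_iff,
      hlt, bot_eq_zero]
    refine or_congr Iff.rfl (exists_congr fun n => ?_)
    tauto
  rw [hEq]
  exact (measurableSet_predictable_singleton_bot_prod
      (measurableSet_filtration_mark_zero _ hB)).union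
    (MeasurableSet.iUnion fun n => (measurableSet_predictable_epoch_lt n hB).diff
      (measurableSet_predictable_epoch_lt (n + 1) MeasurableSet.univ))

theorem predictable_le_prod :
    (filtration X).predictable ≤
      (inferInstance : MeasurableSpace (ℝ≥0 × Trajectory X)) := by
  refine measurableSpace_le_predictable_of_measurableSet (fun S hS => ?_) (fun i S hS => ?_)
  · exact (measurableSet_singleton _).prod ((filtration X).le _ _ hS)
  · exact measurableSet_Ioi.prod ((filtration X).le _ _ hS)

theorem measurable_fst_predictable :
    Measurable[(filtration X).predictable] (Prod.fst : ℝ≥0 × Trajectory X → ℝ≥0) := by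
  let _ : MeasurableSpace (ℝ≥0 × Trajectory X) := (filtration X).predictable
  refine measurable_of_Ioi fun t => ?_
  convert measurableSet_predictable_Ioi_prod (𝓕 := filtration X) (i := t)
    (MeasurableSet.univ : MeasurableSet[filtration X t] Set.univ) using 1
  ext p
  simp

end Trajectory

namespace Model

variable {X A : Type*} [MeasurableSpace X] [MeasurableSpace A] {M : Model X A}

theorem measurableSet_actions (M : Model X A) (x : X) : MeasurableSet (M.actions x) :=
  measurable_prodMk_left (x := x) M.measurableSet_graph

/-! ### Markov policies as policies. -/

namespace MarkovPolicy

/-- The measure `φ(· | x, t)` on the enlarged action space, with `δ_{a_∞}` at `x = x_∞`. -/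
noncomputable def extend (φ : M.MarkovPolicy) (t : ℝ≥0) : X ⊕ Unit → Measure (A ⊕ Unit) :=
  Sum.elim (fun x => (φ.kernel (x, t)).map Sum.inl) (fun _ => Measure.dirac (Sum.inr ()))

/-- The policy determined by a Markov policy. -/
noncomputable def toPolicy (φ : M.MarkovPolicy) : M.Policy where
  toFun t ω := φ.extend t (ω.leftState t)
  isProbabilityMeasure t ω := by
    have := φ.isMarkovKernel
    rcases ω.leftState t with x | u
    · exact Measure.isProbabilityMeasure_map measurable_inl.aemeasurable
    · exact Measure.dirac.isProbabilityMeasure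
  predictable B hB := by
    have hEq : ∀ (t : ℝ≥0) (s : X ⊕ Unit), φ.extend t s (Sum.inl '' B) =
        Sum.elim (fun x => φ.kernel (x, t) B) (fun _ => 0) s := by
      rintro t (x | u)
      · simp [extend, Measure.map_apply measurable_inl hB.inl_image,
          Set.preimage_image_eq _ Sum.inl_injective]
      · simp [extend, hB.inl_image]
    have hg : Measurable fun q : ℝ≥0 × (X ⊕ Unit) =>
        Sum.elim (fun x => φ.kernel (x, q.1) B) (fun _ => (0 : ℝ≥0∞)) q.2 := by
      have hm : Measurable fun q : (X ⊕ Unit) × ℝ≥0 =>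
          Sum.elim (fun x => φ.kernel (x, q.2) B) (fun _ => (0 : ℝ≥0∞)) q.1 := by
        refine (MeasurableEquiv.sumProdDistrib X Unit ℝ≥0).symm.measurable_comp_iff.1 ?_
        refine measurable_fun_sum ?_ ?_
        · exact φ.kernel.measurable_coe hB
        · exact measurable_const
      exact hm.comp measurable_swap
    have hmeas : Measurable[(Trajectory.filtration X).predictable]
        fun p : ℝ≥0 × Trajectory X => φ.extend p.1 (p.2.leftState p.1) (Sum.inl '' B) := by
      simp only [hEq]
      exact hg.comp
        (Trajectory.measurable_fst_predictable.prodMk Trajectory.measurable_leftState)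
    let _ : MeasurableSpace (ℝ≥0 × Trajectory X) := (Trajectory.filtration X).predictable
    exact Measurable.stronglyMeasurable hmeas
  feasible t ω _ x hx := by
    rw [hx]
    simpa [extend, Measure.map_apply measurable_inl (M.measurableSet_actions x).inl_image,
      Set.preimage_image_eq _ Sum.inl_injective] using φ.feasible x t
  exploded t ω h := by
    rcases hx : ω.leftState t with x | u
    · exact absurd (ω.lt_explosionTime_of_leftState_eq hx) (not_lt.2 h)
    · rfl

theorem toPolicy_isGivenBy (φ : M.MarkovPolicy) : φ.toPolicy.IsGivenBy φ := by
  intro t ω _ x hx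
  simp [toPolicy, extend, hx]

end MarkovPolicy

/-! ### No jump at a fixed time. -/

/-- Test the compensator identity with `W = I{s = t}`: the compensator side integrates over a
Lebesgue-null set of times, hence vanishes. -/
theorem IsLaw.ae_epoch_ne [MeasurableSingletonClass X] {γ : Measure X} {π : M.Policy}
    {P : Measure (Trajectory X)} (hP : M.IsLaw γ π P) (t : ℝ≥0) (n : ℕ) :
    ∀ᵐ ω ∂P, ω.epoch (n + 1) ≠ (t : ℝ≥0∞) := by
  classical
  have hW : Measurable[(Trajectory.filtration X).predictable.prod inferInstance]
      (fun q : (ℝ≥0 × Trajectory X) × X => if q.1.1 = t then (1 : ℝ≥0∞) else 0) := by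
    let _ : MeasurableSpace (ℝ≥0 × Trajectory X) := (Trajectory.filtration X).predictable
    have hg : Measurable fun s : ℝ≥0 => if s = t then (1 : ℝ≥0∞) else 0 :=
      Measurable.ite (measurableSet_singleton t) measurable_const measurable_const
    exact (hg.comp Trajectory.measurable_fst_predictable).comp measurable_fst
  have hcomp := hP.compensator _ hW
  have hzero : ∀ ω : Trajectory X, M.compensatorIntegral π ω
      (fun s _ => if s = t then (1 : ℝ≥0∞) else 0) = 0 := by
    intro ω
    rw [compensatorIntegral]
    refine (setLIntegral_congr_fun_ae measurableSet_Ioi (g := fun _ => 0) ?_).trans (by simp)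
    have hne : ∀ᵐ s : ℝ, s ≠ t := by simp [ae_iff]
    filter_upwards [hne] with s hs hpos
    have : s.toNNReal ≠ t := fun h => hs (by rw [← h, Real.coe_toNNReal _ (le_of_lt hpos)])
    simp [this]
  simp only [hzero, lintegral_zero] at hcomp
  have hE : MeasurableSet {ω : Trajectory X | ω.epoch (n + 1) = t} :=
    (Trajectory.measurable_epoch (n + 1)) (measurableSet_singleton _)
  rw [ae_iff]
  simp only [ne_eq, not_not]
  rw [← lintegral_indicator_one hE, ← nonpos_iff_eq_zero, ← hcomp]
  refine lintegral_mono fun ω => ?_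
  by_cases h : ω.epoch (n + 1) = t
  swap
  · rw [Set.indicator_of_notMem (by exact h)]
    exact zero_le
  rw [Set.indicator_of_mem (by exact h)]
  obtain ⟨x, hx⟩ := ω.exists_mark_eq (n := n + 1) (by rw [h]; exact ENNReal.coe_lt_top)
  -- On this event the `n`-th term of the point integral already equals one.
  refine le_trans ?_ (ENNReal.le_tsum n)
  simp [hx, h]

theorem IsLaw.ae_state_eq_leftState [MeasurableSingletonClass X] {γ : Measure X} {π : M.Policy}
    {P : Measure (Trajectory X)} (hP : M.IsLaw γ π P) (t : ℝ≥0) :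
    ∀ᵐ ω ∂P, ω.state t = ω.leftState t := by
  filter_upwards [ae_all_iff.2 (hP.ae_epoch_ne t)] with ω h
  exact ω.state_eq_leftState h

/-! ### The joint law of state and action. -/

/-- A policy, as a transition probability to the enlarged action space. -/
noncomputable def Policy.kernel (π : M.Policy) : Kernel (ℝ≥0 × Trajectory X) (A ⊕ Unit) where
  toFun p := π.toFun p.1 p.2
  measurable' := by
    have hpr := π.isProbabilityMeasure
    have hinl : ∀ B : Set A, MeasurableSet B →
        Measurable fun p : ℝ≥0 × Trajectory X => π.toFun p.1 p.2 (Sum.inl '' B) := fun B hB =>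
      (StronglyMeasurable.measurable (π.predictable B hB)).mono
        Trajectory.predictable_le_prod le_rfl
    refine Measure.measurable_of_measurable_coe _ fun s hs => ?_
    have hs1 : MeasurableSet (Sum.inl ⁻¹' s : Set A) := measurable_inl hs
    by_cases hr : Sum.inr () ∈ s
    · have hEq : s = (Sum.inl '' (Sum.inl ⁻¹' s)ᶜ : Set (A ⊕ Unit))ᶜ := by
        ext (a | ⟨⟩) <;> simp [hr]
      have : ∀ p : ℝ≥0 × Trajectory X, π.toFun p.1 p.2 s =
          1 - π.toFun p.1 p.2 (Sum.inl '' (Sum.inl ⁻¹' s)ᶜ) := fun p => by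
        rw [← prob_compl_eq_one_sub hs1.compl.inl_image, ← hEq]
      simp only [this]
      exact measurable_const.sub (hinl _ hs1.compl)
    · have hEq : s = (Sum.inl '' (Sum.inl ⁻¹' s) : Set (A ⊕ Unit)) := by
        ext (a | ⟨⟩) <;> simp [hr]
      rw [hEq]
      exact hinl _ hs1

instance (π : M.Policy) : IsMarkovKernel π.kernel :=
  ⟨fun p => π.isProbabilityMeasure p.1 p.2⟩

theorem measurableEmbedding_inl_prodMap :
    MeasurableEmbedding (Prod.map Sum.inl Sum.inl : X × A → (X ⊕ Unit) × (A ⊕ Unit)) :=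
  measurableEmbedding_sum_inl.prodMap measurableEmbedding_sum_inl

/-- The law of the pair `(𝕏_t, a_t)` restricted to `X × A`, as a kernel in `t`. -/
noncomputable def stateActionKernel (π : M.Policy) (P : Measure (Trajectory X)) :
    Kernel ℝ≥0 (X × A) :=
  ((Kernel.const ℝ≥0 P) ⊗ₖ
    (Kernel.deterministic _ Trajectory.measurable_state ×ₖ π.kernel)).snd.comapRight
      measurableEmbedding_inl_prodMap

instance (π : M.Policy) (P : Measure (Trajectory X)) [IsFiniteMeasure P] :
    IsFiniteKernel (stateActionKernel π P) := by
  unfold stateActionKernel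
  infer_instance

theorem stateActionKernel_apply (π : M.Policy) (P : Measure (Trajectory X)) [SFinite P]
    (t : ℝ≥0) {S : Set (X × A)} (hS : MeasurableSet S) :
    stateActionKernel π P t S = ∫⁻ ω, π.toFun t ω
      (Prod.mk (ω.state t) ⁻¹' (Prod.map Sum.inl Sum.inl '' S)) ∂P := by
  have hS' := measurableEmbedding_inl_prodMap.measurableSet_image.2 hS
  rw [stateActionKernel, Kernel.comapRight_apply' _ _ _ hS, Kernel.snd_apply' _ _ hS',
    Kernel.compProd_apply (measurable_snd hS')]
  simp only [Kernel.const_apply]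
  refine lintegral_congr fun ω => ?_
  have : Prod.mk ω ⁻¹' {p : Trajectory X × ((X ⊕ Unit) × (A ⊕ Unit)) |
      p.2 ∈ (Prod.map Sum.inl Sum.inl '' S)} = Prod.map Sum.inl Sum.inl '' S := rfl
  erw [this]
  rw [Kernel.prod_apply, Kernel.deterministic_apply, Measure.prod_apply hS',
    lintegral_dirac' _ (measurable_measure_prodMk_left hS')]
  rfl

theorem stateActionKernel_prod (π : M.Policy) (P : Measure (Trajectory X)) [SFinite P]
    (t : ℝ≥0) {B : Set X} (hB : MeasurableSet B) {U : Set A} (hU : MeasurableSet U) :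
    stateActionKernel π P t (B ×ˢ U) = stateActionMarginal π P t U B := by
  have hst : Measurable fun ω : Trajectory X => ω.state t :=
    Trajectory.measurable_state.comp measurable_prodMk_left
  rw [stateActionKernel_apply π P t (hB.prod hU), stateActionMarginal,
    measurableEmbedding_sum_inl.comap_apply, Measure.map_apply hst hB.inl_image,
    withDensity_apply _ (hst hB.inl_image), ← lintegral_indicator (hst hB.inl_image)]
  refine lintegral_congr fun ω => ?_
  rw [Set.prodMap_image_prod]
  by_cases h : ω.state t ∈ Sum.inl '' B
  · rw [Set.mk_preimage_prod_right h, Set.indicator_of_mem (by exact h)]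
  · rw [Set.mk_preimage_prod_right_eq_empty h, Set.indicator_of_notMem (by exact h),
      measure_empty]

theorem IsLaw.ae_feasible [MeasurableSingletonClass X] {γ : Measure X} {π : M.Policy}
    {P : Measure (Trajectory X)} (hP : M.IsLaw γ π P) (t : ℝ≥0) :
    ∀ᵐ ω ∂P, ∀ x, ω.state t = Sum.inl x → π.toFun t ω (Sum.inl '' M.actions x) = 1 := by
  filter_upwards [hP.ae_state_eq_leftState t] with ω h x hx
  rw [h] at hx
  exact π.feasible t ω (ω.lt_explosionTime_of_leftState_eq hx) x hx

/-- Restricting to `X × A` loses no mass over `X`: while `𝕏_t ∈ X`, almost surely `a_∞` has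
probability zero. -/
theorem IsLaw.fst_stateActionKernel [MeasurableSingletonClass X] {γ : Measure X} {π : M.Policy}
    {P : Measure (Trajectory X)} (hP : M.IsLaw γ π P) (t : ℝ≥0) :
    (stateActionKernel π P).fst t = stateMarginal P t := by
  have := hP.isProbabilityMeasure
  have hst : Measurable fun ω : Trajectory X => ω.state t :=
    Trajectory.measurable_state.comp measurable_prodMk_left
  ext B hB
  have hpre : {p : X × A | p.1 ∈ B} = B ×ˢ Set.univ := by
    ext p
    simp
  rw [Kernel.fst_apply' _ _ hB, hpre, stateActionKernel_prod π P t hB MeasurableSet.univ,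
    stateActionMarginal, stateMarginal, measurableEmbedding_sum_inl.comap_apply,
    measurableEmbedding_sum_inl.comap_apply, Measure.map_apply hst hB.inl_image,
    Measure.map_apply hst hB.inl_image, withDensity_apply _ (hst hB.inl_image),
    ← setLIntegral_one]
  refine setLIntegral_congr_fun_ae (hst hB.inl_image) ?_
  filter_upwards [hP.ae_feasible t] with ω h hω
  obtain ⟨x, -, hx⟩ := hω
  have := π.isProbabilityMeasure t ω
  exact le_antisymm prob_le_one
    ((h x hx.symm).symm.le.trans (measure_mono (Set.image_mono (Set.subset_univ _))))

theorem IsLaw.stateActionKernel_compl_graph [MeasurableSingletonClass X] {γ : Measure X}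
    {π : M.Policy} {P : Measure (Trajectory X)} (hP : M.IsLaw γ π P) (t : ℝ≥0) :
    stateActionKernel π P t {p : X × A | p.2 ∈ M.actions p.1}ᶜ = 0 := by
  have := hP.isProbabilityMeasure
  rw [stateActionKernel_apply π P t M.measurableSet_graph.compl]
  refine (lintegral_congr_ae (g := fun _ => 0) ?_).trans (by simp)
  filter_upwards [hP.ae_feasible t] with ω h
  have := π.isProbabilityMeasure t ω
  rcases hx : ω.state t with x | u
  · refine measure_mono_null ?_
      ((prob_compl_eq_zero_iff (M.measurableSet_actions x).inl_image).2 (h x hx))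
    rintro a ⟨⟨y, b⟩, hyb, hya⟩ ⟨c, hc, rfl⟩
    simp only [Prod.map_apply, Prod.mk.injEq, Sum.inl.injEq] at hya
    obtain ⟨rfl, rfl⟩ := hya
    exact hyb hc
  -- At `x_∞` the section is empty, since the image only contains genuine states.
  · refine measure_mono_null (t := ∅) ?_ measure_empty
    rintro a ⟨⟨y, b⟩, hyb, hya⟩
    simp at hya

/-! ### Disintegration and correction by a selector. -/

section Disintegration

variable [StandardBorelSpace X] [StandardBorelSpace A] [Nonempty A]

/-- The conditional law of `a_t` given `𝕏_t = x`, jointly measurable in `(x, t)`. -/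
noncomputable def condActionKernel (π : M.Policy) (P : Measure (Trajectory X))
    [IsFiniteMeasure P] : Kernel (X × ℝ≥0) A :=
  (stateActionKernel π P).condKernel.comap Prod.swap measurable_swap

instance (π : M.Policy) (P : Measure (Trajectory X)) [IsFiniteMeasure P] :
    IsMarkovKernel (condActionKernel π P) := by
  unfold condActionKernel
  infer_instance

theorem IsLaw.stateActionKernel_eq_lintegral {γ : Measure X} {π : M.Policy}
    {P : Measure (Trajectory X)} [IsFiniteMeasure P] (hP : M.IsLaw γ π P) (t : ℝ≥0)
    {S : Set (X × A)} (hS : MeasurableSet S) :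
    stateActionKernel π P t S =
      ∫⁻ x, condActionKernel π P (x, t) (Prod.mk x ⁻¹' S) ∂(stateMarginal P t) := by
  conv_lhs => rw [← (stateActionKernel π P).disintegrate (stateActionKernel π P).condKernel]
  rw [Kernel.compProd_apply hS, hP.fst_stateActionKernel]
  rfl

/-- The joint law does not charge the complement of `Gr(A)`; disintegrating this null set makes
almost every section null. -/
theorem IsLaw.ae_condActionKernel_actions {γ : Measure X} {π : M.Policy}
    {P : Measure (Trajectory X)} [IsFiniteMeasure P] (hP : M.IsLaw γ π P) (t : ℝ≥0) :
    ∀ᵐ x ∂(stateMarginal P t), condActionKernel π P (x, t) (M.actions x) = 1 := by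
  have h0 := hP.stateActionKernel_compl_graph t
  rw [hP.stateActionKernel_eq_lintegral t M.measurableSet_graph.compl] at h0
  have hm : Measurable fun x =>
      condActionKernel π P (x, t) (Prod.mk x ⁻¹' {p : X × A | p.2 ∈ M.actions p.1}ᶜ) :=
    Kernel.measurable_kernel_prodMk_left
      (κ := (condActionKernel π P).comap (fun x => (x, t)) measurable_prodMk_right)
      M.measurableSet_graph.compl
  filter_upwards [(lintegral_eq_zero_iff hm).1 h0] with x hx
  exact (prob_compl_eq_zero_iff (M.measurableSet_actions x)).1 hx

theorem IsLaw.stateActionMarginal_eq_withDensity {γ : Measure X} {π : M.Policy}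
    {P : Measure (Trajectory X)} [IsFiniteMeasure P] (hP : M.IsLaw γ π P) (t : ℝ≥0)
    {U : Set A} (hU : MeasurableSet U) :
    stateActionMarginal π P t U =
      (stateMarginal P t).withDensity fun x => condActionKernel π P (x, t) U := by
  ext B hB
  rw [← stateActionKernel_prod π P t hB hU, hP.stateActionKernel_eq_lintegral t (hB.prod hU),
    withDensity_apply _ hB, ← lintegral_indicator hB]
  refine lintegral_congr fun x => ?_
  by_cases h : x ∈ B
  · rw [Set.mk_preimage_prod_right h, Set.indicator_of_mem h]
  · rw [Set.mk_preimage_prod_right_eq_empty h, Set.indicator_of_notMem h, measure_empty]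

/-- Since `A(x)` moves with `x`, evaluation at a fixed set does not suffice; `A(x)` is treated as a
section of the measurable graph. -/
theorem measurableSet_condActionKernel_actions (π : M.Policy) (P : Measure (Trajectory X))
    [IsFiniteMeasure P] :
    MeasurableSet {p : X × ℝ≥0 | condActionKernel π P p (M.actions p.1) = 1} := by
  have hm : Measurable fun p : X × ℝ≥0 => condActionKernel π P p
      (Prod.mk p ⁻¹' {q : (X × ℝ≥0) × A | q.2 ∈ M.actions q.1.1}) :=
    Kernel.measurable_kernel_prodMk_left
      (((measurable_fst.comp measurable_fst).prodMk measurable_snd) M.measurableSet_graph)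
  exact hm (measurableSet_singleton 1)

open Classical in
/-- The Markov policy given by the conditional law of `a_t` given `𝕏_t = x`, corrected by a
measurable selector where this law is not concentrated on `A(x)`. -/
noncomputable def condMarkovPolicy (π : M.Policy) (P : Measure (Trajectory X))
    [IsFiniteMeasure P] : M.MarkovPolicy where
  kernel := Kernel.piecewise (measurableSet_condActionKernel_actions π P) (condActionKernel π P)
    (Kernel.deterministic (fun p => M.exists_selector.choose p.1)
      (M.exists_selector.choose_spec.1.comp measurable_fst))
  isMarkovKernel := inferInstance
  feasible x t := by
    rw [Kernel.piecewise_apply']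
    split_ifs with h
    · exact h
    · rw [Kernel.deterministic_apply' _ _ (M.measurableSet_actions x)]
      exact Set.indicator_of_mem (M.exists_selector.choose_spec.2 x) _

theorem IsLaw.ae_condMarkovPolicy_eq {γ : Measure X} {π : M.Policy}
    {P : Measure (Trajectory X)} [IsFiniteMeasure P] (hP : M.IsLaw γ π P) (t : ℝ≥0) :
    ∀ᵐ x ∂(stateMarginal P t),
      (condMarkovPolicy π P).kernel (x, t) = condActionKernel π P (x, t) := by
  classical
  filter_upwards [hP.ae_condActionKernel_actions t] with x hx
  rw [condMarkovPolicy, Kernel.piecewise_apply]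
  exact if_pos hx

end Disintegration

end Model

end CTJMDP

theorem lemma4p1 {X A : Type*} [MeasurableSpace X] [StandardBorelSpace X]
    [MeasurableSpace A] [StandardBorelSpace A] (M : CTJMDP.Model X A)
    (γ : Measure X) [IsProbabilityMeasure γ] (π : M.Policy)
    (P : Measure (CTJMDP.Trajectory X)) (hP : M.IsLaw γ π P) :
    ∃ φ : M.MarkovPolicy,
      (∃ σ : M.Policy, σ.IsGivenBy φ) ∧
      ∀ (t : ℝ≥0) (U : Set A), MeasurableSet U →
        CTJMDP.Model.stateActionMarginal π P t U ≪ CTJMDP.Model.stateMarginal P t ∧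
        (fun x => φ.kernel (x, t) U) =ᵐ[CTJMDP.Model.stateMarginal P t]
          (CTJMDP.Model.stateActionMarginal π P t U).rnDeriv
            (CTJMDP.Model.stateMarginal P t) := by
  have := hP.isProbabilityMeasure
  obtain ⟨x₀⟩ : Nonempty X := nonempty_of_isProbabilityMeasure γ
  -- Disintegration needs a nonempty action space; the selector at any state supplies a point.
  have : Nonempty A := ⟨M.exists_selector.choose x₀⟩
  refine ⟨CTJMDP.Model.condMarkovPolicy π P, ⟨_, CTJMDP.Model.MarkovPolicy.toPolicy_isGivenBy _⟩,
    fun t U hU => ?_⟩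
  have : IsFiniteMeasure (CTJMDP.Model.stateMarginal P t) := by
    rw [← hP.fst_stateActionKernel t]
    infer_instance
  rw [hP.stateActionMarginal_eq_withDensity t hU]
  refine ⟨withDensity_absolutelyContinuous _ _, ?_⟩
  have hm : Measurable fun x => CTJMDP.Model.condActionKernel π P (x, t) U :=
    ((CTJMDP.Model.condActionKernel π P).measurable_coe hU).comp measurable_prodMk_right
  filter_upwards [hP.ae_condMarkovPolicy_eq t, Measure.rnDeriv_withDensity _ hm] with x h1 h2
  rw [h1, h2]
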